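/- Let $G$ be a locally compact (Hausdorff) group. Let $M(G)$ be its measure algebra, i.e. the algebra of all regular complex Borel measures on $G$ under convolution, and let $L^1(G)$ be its group algebra, regarded as a subalgebra of $M(G)$ by identifying an integrable function $f$ with the measure $f\,d\lambda$, where $\lambda$ is a left Haar measure. For a complex algebra $A$ let $\mathrm{Soc}(A)$ denote its left socle, i.e. the smallest left ideal of $A$ that contains all minimal left ideals of $A$ (so $\mathrm{Soc}(A)=(0)$ if $A$ has no minimal left ideals). Then $G$ is compact if any one of the following conditions holds: (1) there exists a measure $\mu\in\mathrm{Soc}(L^1(G))$ such that $\mu(G)\neq 0$; (2) there exists a measure $\mu\in\mathrm{Soc}(M(G))$ such that $\mu(G)\neq 0$; (3) $G$ is abelian and $\mathrm{Soc}(L^1(G))\neq (0)$. -/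

import Mathlib

open MeasureTheory CompactlySupported

namespace LCGroup

/-- The integral `∫ f dμ` of a complex function against a complex measure. -/
noncomputable def cintegral {X : Type*} [MeasurableSpace X] (μ : ComplexMeasure X) (f : X → ℂ) :
    ℂ :=
  μ.integral f (ContinuousLinearMap.mul ℝ ℂ)

section Aux

variable {X : Type*} [MeasurableSpace X]

/-- The complex measure `z p` for a complex number `z` and a finite positive measure `p`. -/
noncomputable def zMeas (z : ℂ) (p : Measure X) [IsFiniteMeasure p] : ComplexMeasure X :=
  z • p.toSignedMeasure.mapRange Complex.ofRealHom.toAddMonoidHom Complex.continuous_ofReal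

lemma zMeas_apply (z : ℂ) (p : Measure X) [IsFiniteMeasure p] {s : Set X} (hs : MeasurableSet s) :
    zMeas z p s = z * (p.real s : ℂ) := by
  simp [zMeas, Measure.toSignedMeasure_apply_measurable hs]

lemma variation_zMeas {z : ℂ} (hz : ‖z‖ = 1) (p : Measure X) [IsFiniteMeasure p] :
    (zMeas z p).variation = p := by
  have key : ∀ s, MeasurableSet s → ‖zMeas z p s‖ₑ = p s := by
    intro s hs
    rw [zMeas_apply z p hs, enorm_mul, ← ofReal_norm, hz, ← ofReal_norm,
      Complex.norm_real, Real.norm_of_nonneg measureReal_nonneg]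
    simp
  apply le_antisymm
  · exact VectorMeasure.variation_le_of_forall_enorm_le fun s hs => (key s hs).le
  · refine Measure.le_iff.2 fun s hs => ?_
    rw [← key s hs]
    exact VectorMeasure.enorm_measure_le_variation _ _

lemma cintegral_zMeas {z : ℂ} (hz : ‖z‖ = 1) (p : Measure X) [IsFiniteMeasure p] {f : X → ℂ}
    (hf : Integrable f p) : cintegral (zMeas z p) f = z * ∫ x, f x ∂p := by
  unfold cintegral
  rw [VectorMeasure.integral_eq_setToFun]
  have hT := dominatedFinMeasAdditive_cbmApplyMeasure (zMeas z p) (ContinuousLinearMap.mul ℝ ℂ)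
  have hv := variation_zMeas hz p
  suffices H : ∀ (q : Measure X) (hq : q = p) (hT : DominatedFinMeasAdditive q
      ((zMeas z p).transpose (ContinuousLinearMap.mul ℝ ℂ)) ‖ContinuousLinearMap.mul ℝ ℂ‖),
      setToFun q _ hT f = z * ∫ x, f x ∂p from H _ hv _
  rintro q rfl hT
  refine Integrable.induction (fun f => setToFun q _ hT f = z * ∫ x, f x ∂q) ?_ ?_ ?_ ?_ hf
  · intro c s hs h
    rw [setToFun_indicator_const hT hs h.ne, integral_indicator_const _ hs]
    change c * zMeas z q s = _
    rw [zMeas_apply z q hs, Complex.real_smul]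
    ring
  · intro f g _ hf hg h1 h2
    rw [setToFun_add hT hf hg, h1, h2, ← mul_add]
    congr 1
    exact (integral_add hf hg).symm
  · exact isClosed_eq (continuous_setToFun hT) (continuous_const.mul continuous_integral)
  · intro f g h hf h1
    rw [← setToFun_congr_ae hT h, h1, integral_congr_ae h]

lemma regular_of_le [TopologicalSpace X] [T2Space X] [BorelSpace X] {p q : Measure X}
    [IsFiniteMeasure q] [q.Regular] (h : p ≤ q) : p.Regular := by
  have : IsFiniteMeasure p := isFiniteMeasure_of_le q h
  have : p.InnerRegular := by
    constructor
    intro A hA r hr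
    obtain ⟨ε, hε, hr'⟩ : ∃ ε > 0, r + ε < p A := by
      obtain ⟨ε, hε, h'⟩ := ENNReal.lt_iff_exists_add_pos_lt.1 hr
      exact ⟨ε, by exact_mod_cast hε, h'⟩
    obtain ⟨K, hKA, hK, hlt⟩ := hA.exists_isCompact_sdiff_lt (measure_ne_top q A) hε.ne'
    refine ⟨K, hKA, hK, ?_⟩
    have h1 : p A ≤ p K + p (A \ K) := by
      rw [measure_add_sdiff hK.measurableSet.nullMeasurableSet]
      exact measure_mono Set.subset_union_right
    have h2 : p (A \ K) < ε := (h _).trans_lt hlt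
    by_contra! h3
    exact absurd (hr'.trans_le (h1.trans (add_le_add h3 h2.le))) (lt_irrefl _)
  infer_instance

/-- The numbers `1, -1, i, -i`. -/
def unit4 : Fin 4 → ℂ := ![1, -1, Complex.I, -Complex.I]

lemma norm_unit4 (i : Fin 4) : ‖unit4 i‖ = 1 := by
  fin_cases i <;> simp [unit4]

/-- A complex measure is a combination of four finite positive measures, which are regular if its
total variation is. -/
lemma exists_decomp (μ : ComplexMeasure X) :
    ∃ (p : Fin 4 → Measure X) (_ : ∀ i, IsFiniteMeasure (p i)),
      (∀ i, p i ≤ μ.variation) ∧ μ = ∑ i, zMeas (unit4 i) (p i) := by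
  let a := (ComplexMeasure.re μ).toJordanDecomposition
  let b := (ComplexMeasure.im μ).toJordanDecomposition
  have hre : (ComplexMeasure.re μ).variation ≤ μ.variation := by
    refine VectorMeasure.variation_le_of_forall_enorm_le fun s _ => ?_
    refine le_trans ?_ (VectorMeasure.enorm_measure_le_variation μ s)
    rw [← ofReal_norm, ← ofReal_norm]
    exact ENNReal.ofReal_le_ofReal (Complex.abs_re_le_norm _)
  have him : (ComplexMeasure.im μ).variation ≤ μ.variation := by
    refine VectorMeasure.variation_le_of_forall_enorm_le fun s _ => ?_
    refine le_trans ?_ (VectorMeasure.enorm_measure_le_variation μ s)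
    rw [← ofReal_norm, ← ofReal_norm]
    exact ENNReal.ofReal_le_ofReal (Complex.abs_im_le_norm _)
  rw [← SignedMeasure.totalVariation_eq_variation] at hre him
  let p : Fin 4 → Measure X := ![a.posPart, a.negPart, b.posPart, b.negPart]
  have hp : ∀ i, IsFiniteMeasure (p i) := by
    intro i
    fin_cases i <;> simp [p] <;> infer_instance
  refine ⟨p, hp, ?_, ?_⟩
  · intro i
    fin_cases i
    · exact (Measure.le_add_right le_rfl).trans hre
    · exact (Measure.le_add_left le_rfl).trans hre
    · exact (Measure.le_add_right le_rfl).trans him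
    · exact (Measure.le_add_left le_rfl).trans him
  · ext s hs
    have e1 := (ComplexMeasure.re μ).apply_eq_posPart_real_sub_negPart_real hs
    have e2 := (ComplexMeasure.im μ).apply_eq_posPart_real_sub_negPart_real hs
    have e3 : μ s = ((ComplexMeasure.re μ s : ℝ) : ℂ) + ((ComplexMeasure.im μ s : ℝ) : ℂ) *
      Complex.I := (Complex.re_add_im _).symm
    rw [e3, e1, e2]
    simp only [Fin.sum_univ_four, add_apply, zMeas_apply _ _ hs]
    simp [p, a, b, unit4]
    ring

instance isFiniteMeasure_variation (μ : ComplexMeasure X) : IsFiniteMeasure μ.variation := by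
  obtain ⟨p, hp, -, h⟩ := exists_decomp μ
  rw [h]
  refine isFiniteMeasure_of_le (∑ i, p i) ?_
  refine (VectorMeasure.variation_finsetSum_le _ _).trans (le_of_eq ?_)
  exact Finset.sum_congr rfl fun i _ => variation_zMeas (norm_unit4 i) (p i)

end Aux

section Sums

variable {X : Type*} [MeasurableSpace X]

lemma cintegral_sum {ι : Type*} [Fintype ι] (z : ι → ℂ) (hz : ∀ i, ‖z i‖ = 1)
    (p : ι → Measure X) [∀ i, IsFiniteMeasure (p i)] {f : X → ℂ} (hf : ∀ i, Integrable f (p i)) :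
    cintegral (∑ i, zMeas (z i) (p i)) f = ∑ i, z i * ∫ x, f x ∂(p i) := by
  unfold cintegral
  rw [VectorMeasure.integral_finsetSum_vectorMeasure]
  · exact Finset.sum_congr rfl fun i _ => cintegral_zMeas (hz i) (p i) (hf i)
  · intro i _
    change Integrable f _
    rw [variation_zMeas (hz i)]
    exact hf i

lemma regular_sum [TopologicalSpace X] [T2Space X] [BorelSpace X] {ι : Type*} [Fintype ι]
    (z : ι → ℂ) (hz : ∀ i, ‖z i‖ = 1) (p : ι → Measure X) [∀ i, IsFiniteMeasure (p i)]
    [∀ i, (p i).Regular] : (∑ i, zMeas (z i) (p i)).variation.Regular := by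
  have : ∀ i, (p i).InnerRegular := fun i => inferInstance
  have h1 : (∑ i, p i).InnerRegular := inferInstance
  have h2 : (∑ i, p i).Regular := inferInstance
  refine regular_of_le (q := ∑ i, p i) ?_
  refine (VectorMeasure.variation_finsetSum_le _ _).trans (le_of_eq ?_)
  exact Finset.sum_congr rfl fun i _ => variation_zMeas (hz i) (p i)

lemma integrable_of_compactSupport [TopologicalSpace X] [BorelSpace X] (p : Measure X)
    [IsFiniteMeasure p] {E : Type*} [NormedAddCommGroup E] [SecondCountableTopology E]
    (f : C_c(X, E)) : Integrable f p := by
  obtain ⟨C, hC⟩ := f.hasCompactSupport.exists_bound_of_continuous f.continuous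
  exact Integrable.of_bound f.continuous.aestronglyMeasurable C (.of_forall hC)

end Sums

section Conv

variable {G : Type*} [Group G] [TopologicalSpace G] [IsTopologicalGroup G] [LocallyCompactSpace G]
  [MeasurableSpace G] [BorelSpace G]

/-- The function `y ↦ f (x y)`. -/
def translate {E : Type*} [NormedAddCommGroup E] (f : C_c(G, E)) (x : G) : C_c(G, E) where
  toFun y := f (x * y)
  continuous_toFun := f.continuous.comp (continuous_const_mul x)
  hasCompactSupport' := f.hasCompactSupport.comp_homeomorph (Homeomorph.mulLeft x)

lemma continuous_inner (q : Measure G) [IsFiniteMeasure q] {E : Type*} [NormedAddCommGroup E]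
    [NormedSpace ℝ E] (f : C_c(G, E)) : Continuous fun x => ∫ y, f (x * y) ∂q := by
  have k_comp : IsCompact (tsupport f) := f.hasCompactSupport
  refine continuous_iff_continuousAt.2 fun x₀ => ?_
  obtain ⟨t, t_comp, ht⟩ := exists_compact_mem_nhds x₀
  refine ContinuousOn.continuousAt (s := t) ?_ ht
  refine continuousOn_integral_of_compact_support (t_comp.inv.mul k_comp)
    (f.continuous.comp (continuous_fst.mul continuous_snd)).continuousOn ?_
  intro x y hx hy
  contrapose! hy
  exact ⟨x⁻¹, by simpa using hx, x * y, subset_tsupport _ hy, by simp⟩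

lemma integrable_inner (p q : Measure G) [IsFiniteMeasure p] [IsFiniteMeasure q] {E : Type*}
    [NormedAddCommGroup E] [NormedSpace ℝ E] [SecondCountableTopology E] (f : C_c(G, E)) :
    Integrable (fun x => ∫ y, f (x * y) ∂q) p := by
  obtain ⟨C, hC⟩ := f.hasCompactSupport.exists_bound_of_continuous f.continuous
  refine Integrable.of_bound (continuous_inner q f).aestronglyMeasurable (C * q.real Set.univ)
    (.of_forall fun x => ?_)
  exact norm_integral_le_of_norm_le_const (.of_forall fun y => hC _)

/-- The positive functional `f ↦ ∫∫ f (x y) dq(y) dp(x)`. -/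
noncomputable def convFunctional (p q : Measure G) [IsFiniteMeasure p] [IsFiniteMeasure q] :
    C_c(G, ℝ) →ₚ[ℝ] ℝ :=
  PositiveLinearMap.mk₀
    { toFun := fun f => ∫ x, ∫ y, f (x * y) ∂q ∂p
      map_add' := fun f g => by
        rw [← integral_add (integrable_inner p q f) (integrable_inner p q g)]
        refine integral_congr_ae (.of_forall fun x => ?_)
        exact integral_add (integrable_of_compactSupport q (translate f x))
          (integrable_of_compactSupport q (translate g x))
      map_smul' := fun c f => by
        simp [integral_const_mul] }
    fun f hf => integral_nonneg fun x => integral_nonneg fun y => hf _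

lemma exists_conv_pos [T2Space G] (p q : Measure G) [IsFiniteMeasure p] [IsFiniteMeasure q] :
    ∃ r : Measure G, ∃ _ : IsFiniteMeasure r, r.Regular ∧
      ∀ f : C_c(G, ℂ), ∫ x, f x ∂r = ∫ x, ∫ y, f (x * y) ∂q ∂p := by
  let r := RealRMK.rieszMeasure (convFunctional p q)
  have hfin : IsFiniteMeasure r := by
    constructor
    rw [isOpen_univ.measure_eq_iSup_isCompact]
    refine (iSup_le fun K => iSup_le fun _ => iSup_le fun hK => ?_ :
      _ ≤ ENNReal.ofReal (q.real Set.univ * p.real Set.univ)).trans_lt ENNReal.ofReal_lt_top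
    obtain ⟨f, hf1, hf2, hf3⟩ :=
      exists_continuousMap_one_of_isCompact_subset_isOpen hK isOpen_univ (Set.subset_univ K)
    have hcs : HasCompactSupport f := hf2
    let g : C_c(G, ℝ) := ⟨f, hcs⟩
    have hg : ∀ x, g x ∈ Set.Icc (0 : ℝ) 1 := fun x => hf3.2 x
    refine (RealRMK.rieszMeasure_le_of_eq_one _ (f := g) (fun x => (hg x).1) hK
      fun x hx => hf1 hx).trans (ENNReal.ofReal_le_ofReal ?_)
    change ∫ x, ∫ y, g (x * y) ∂q ∂p ≤ _
    have h1 : ∀ x, ‖∫ y, g (x * y) ∂q‖ ≤ q.real Set.univ := fun x => by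
      refine (norm_integral_le_of_norm_le_const (C := 1) (.of_forall fun y => ?_)).trans
        (by simp)
      rw [Real.norm_of_nonneg (hg _).1]
      exact (hg _).2
    exact (le_abs_self _).trans (norm_integral_le_of_norm_le_const (.of_forall h1))
  refine ⟨r, hfin, inferInstance, fun f => ?_⟩
  let fr : C_c(G, ℝ) := ⟨⟨fun x => (f x).re, Complex.continuous_re.comp f.continuous⟩,
    f.hasCompactSupport.comp_left Complex.zero_re⟩
  let fi : C_c(G, ℝ) := ⟨⟨fun x => (f x).im, Complex.continuous_im.comp f.continuous⟩,
    f.hasCompactSupport.comp_left Complex.zero_im⟩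
  have hr : ∫ x, fr x ∂r = ∫ x, ∫ y, fr (x * y) ∂q ∂p :=
    RealRMK.integral_rieszMeasure (convFunctional p q) fr
  have hi : ∫ x, fi x ∂r = ∫ x, ∫ y, fi (x * y) ∂q ∂p :=
    RealRMK.integral_rieszMeasure (convFunctional p q) fi
  have re_im : ∀ (m : Measure G) (h : G → ℂ), Integrable h m →
      ∫ x, h x ∂m = ((∫ x, (h x).re ∂m : ℝ) : ℂ) + ((∫ x, (h x).im ∂m : ℝ) : ℂ) * Complex.I :=
    fun m h hh => (integral_re_add_im hh).symm
  have hin : ∀ x, Integrable (fun y => f (x * y)) q := fun x =>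
    integrable_of_compactSupport q (translate f x)
  have e1 : ∀ x, (∫ y, f (x * y) ∂q).re = ∫ y, fr (x * y) ∂q := fun x => by
    rw [re_im _ _ (hin x)]; simp [fr]
  have e2 : ∀ x, (∫ y, f (x * y) ∂q).im = ∫ y, fi (x * y) ∂q := fun x => by
    rw [re_im _ _ (hin x)]; simp [fi]
  rw [re_im r f (integrable_of_compactSupport r f), re_im p _ (integrable_inner p q f)]
  simp_rw [e1, e2]
  rw [← hr, ← hi]
  rfl

end Conv

section MeasureAlgebra

variable (G : Type*) [TopologicalSpace G] [T2Space G] [MeasurableSpace G] [BorelSpace G]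

/-- The space of regular complex Borel measures, i.e. those with regular total variation. -/
def regularComplexMeasures : Submodule ℂ (ComplexMeasure G) where
  carrier := {μ | μ.variation.Regular}
  zero_mem' := by
    rw [Set.mem_ofPred_eq, VectorMeasure.variation_zero]
    infer_instance
  add_mem' := fun {μ ν} hμ hν => by
    rw [Set.mem_ofPred_eq] at *
    have h1 : (μ.variation + ν.variation).InnerRegular := inferInstance
    have h2 : (μ.variation + ν.variation).Regular := inferInstance
    exact regular_of_le VectorMeasure.variation_add_le
  smul_mem' := fun c μ hμ => by
    rw [Set.mem_ofPred_eq] at *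
    rw [VectorMeasure.variation_smul]
    infer_instance

/-- The measure algebra `M(G)`: all regular complex Borel measures on `G`. -/
abbrev MeasureAlgebra := ↥(regularComplexMeasures G)

variable {G}

/-- A regular complex measure is determined by the integrals of compactly supported functions. -/
lemma eq_zero_of_cintegral [LocallyCompactSpace G] {μ : ComplexMeasure G}
    (hμ : μ ∈ regularComplexMeasures G) (h : ∀ f : C_c(G, ℂ), cintegral μ f = 0) : μ = 0 := by
  have hμ' : μ.variation.Regular := hμ
  obtain ⟨p, hp, hle, hsum⟩ := exists_decomp μ
  have hreg : ∀ i, (p i).Regular := fun i => regular_of_le (hle i)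
  have key : ∀ f : C_c(G, ℝ), ∫ x, f x ∂(p 0) = ∫ x, f x ∂(p 1) ∧
      ∫ x, f x ∂(p 2) = ∫ x, f x ∂(p 3) := by
    intro f
    let g : C_c(G, ℂ) := ⟨⟨fun x => (f x : ℂ), Complex.continuous_ofReal.comp f.continuous⟩,
      f.hasCompactSupport.comp_left Complex.ofReal_zero⟩
    have h1 := h g
    rw [hsum, cintegral_sum _ norm_unit4 p fun i => integrable_of_compactSupport (p i) g] at h1
    have h2 : ∀ i, ∫ x, g x ∂(p i) = ((∫ x, f x ∂(p i) : ℝ) : ℂ) := fun i =>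
      integral_ofReal
    simp only [h2, Fin.sum_univ_four] at h1
    have h3 := congrArg Complex.re h1
    have h4 := congrArg Complex.im h1
    simp [unit4] at h3 h4
    exact ⟨by linarith, by linarith⟩
  have e1 : p 0 = p 1 := Measure.ext_of_integral_eq_on_compactlySupported fun f => (key f).1
  have e2 : p 2 = p 3 := Measure.ext_of_integral_eq_on_compactlySupported fun f => (key f).2
  rw [hsum]
  ext s hs
  simp only [Fin.sum_univ_four, add_apply, zMeas_apply _ _ hs, e1, e2]
  simp [unit4]

variable [Group G] [IsTopologicalGroup G] [LocallyCompactSpace G]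

/-- For `μ, ν` in `M(G)` there is exactly one `ρ` in `M(G)` with
`∫ f dρ = ∫∫ f(xy) dν(y) dμ(x)` for all compactly supported continuous `f`. -/
theorem existsUnique_conv (μ ν : MeasureAlgebra G) :
    ∃! ρ : MeasureAlgebra G, ∀ f : C_c(G, ℂ),
      cintegral (ρ : ComplexMeasure G) f =
        cintegral (μ : ComplexMeasure G) fun x =>
          cintegral (ν : ComplexMeasure G) fun y => f (x * y) := by
  obtain ⟨p, hp, -, hμ⟩ := exists_decomp (μ : ComplexMeasure G)
  obtain ⟨q, hq, -, hν⟩ := exists_decomp (ν : ComplexMeasure G)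
  choose r hr hreg hint using fun ij : Fin 4 × Fin 4 => exists_conv_pos (p ij.1) (q ij.2)
  let z : Fin 4 × Fin 4 → ℂ := fun ij => unit4 ij.1 * unit4 ij.2
  have hz : ∀ ij, ‖z ij‖ = 1 := fun ij => by simp [z, norm_unit4]
  let ρ₀ : MeasureAlgebra G := ⟨∑ ij, zMeas (z ij) (r ij), regular_sum z hz r⟩
  have h0 : ∀ f : C_c(G, ℂ), cintegral (ρ₀ : ComplexMeasure G) f =
      cintegral (μ : ComplexMeasure G) fun x =>
        cintegral (ν : ComplexMeasure G) fun y => f (x * y) := by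
    intro f
    have inner : ∀ x, (cintegral (ν : ComplexMeasure G) fun y => f (x * y)) =
        ∑ j, unit4 j * ∫ y, f (x * y) ∂(q j) := fun x => by
      rw [hν]
      exact cintegral_sum _ norm_unit4 q fun j => integrable_of_compactSupport (q j) (translate f x)
    simp_rw [inner]
    have hin : ∀ i j, Integrable (fun x => unit4 j * ∫ y, f (x * y) ∂(q j)) (p i) := fun i j =>
      (integrable_inner (p i) (q j) f).const_mul _
    rw [hμ, cintegral_sum _ norm_unit4 p fun i => integrable_finsetSum _ fun j _ => hin i j]
    refine (cintegral_sum z hz r fun ij => integrable_of_compactSupport (r ij) f).trans ?_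
    rw [Fintype.sum_prod_type]
    refine Finset.sum_congr rfl fun i _ => ?_
    rw [integral_finsetSum _ fun j _ => hin i j, Finset.mul_sum]
    refine Finset.sum_congr rfl fun j _ => ?_
    rw [hint, integral_const_mul, ← mul_assoc]
  refine ⟨ρ₀, h0, fun ρ hρ => Subtype.ext (sub_eq_zero.1 ?_)⟩
  refine eq_zero_of_cintegral (Submodule.sub_mem _ ρ.2 ρ₀.2) fun f => ?_
  have := VectorMeasure.integral_sub_vectorMeasure (B := ContinuousLinearMap.mul ℝ ℂ)
    (integrable_of_compactSupport (ρ : ComplexMeasure G).variation f)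
    (integrable_of_compactSupport (ρ₀ : ComplexMeasure G).variation f)
  refine this.trans (sub_eq_zero.2 ?_)
  exact (hρ f).trans (h0 f).symm

/-- Convolution of measures: `μ * ν` is the regular complex measure with
`∫ f d(μ * ν) = ∫∫ f(xy) dν(y) dμ(x)` for all compactly supported continuous `f`. -/
noncomputable instance : Mul (MeasureAlgebra G) where
  mul μ ν := (existsUnique_conv μ ν).choose

theorem mul_spec (μ ν : MeasureAlgebra G) (f : C_c(G, ℂ)) :
    cintegral ((μ * ν : MeasureAlgebra G) : ComplexMeasure G) f =
      cintegral (μ : ComplexMeasure G) fun x =>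
        cintegral (ν : ComplexMeasure G) fun y => f (x * y) :=
  (existsUnique_conv μ ν).choose_spec.1 f

variable (G) in
/-- The group algebra `L¹(G)` inside `M(G)`: the measures `f dλ`, where `λ` is a left Haar measure
and `f` is an integrable complex function. The convolution of functions is the convolution of the
measures that they represent, and `(f dλ)(G) = ∫ f dλ`. -/
noncomputable def groupAlgebra : Submodule ℂ (MeasureAlgebra G) where
  carrier := {μ | ∃ f : G → ℂ, Integrable f Measure.haar ∧
    (μ : ComplexMeasure G) = Measure.haar.withDensityᵥ f}
  zero_mem' := ⟨0, integrable_zero _ _ _, by simp⟩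
  add_mem' := by
    rintro μ ν ⟨f, hf, h1⟩ ⟨g, hg, h2⟩
    exact ⟨f + g, hf.add hg, by rw [withDensityᵥ_add hf hg, ← h1, ← h2]; rfl⟩
  smul_mem' := by
    rintro c μ ⟨f, hf, h1⟩
    exact ⟨c • f, hf.smul c, by rw [withDensityᵥ_smul f c, ← h1]; rfl⟩

end MeasureAlgebra

section Socle

variable {A : Type*} [AddCommMonoid A] [Module ℂ A] [Mul A]

/-- `I` is a left ideal of the subalgebra `B` of the complex algebra `A`. -/
def IsLeftIdeal (B I : Submodule ℂ A) : Prop :=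
  I ≤ B ∧ ∀ b ∈ B, ∀ x ∈ I, b * x ∈ I

/-- `I` is a minimal left ideal of the subalgebra `B`: a nonzero left ideal of `B` that contains no
left ideal of `B` other than `0` and `I`. -/
def IsMinimalLeftIdeal (B I : Submodule ℂ A) : Prop :=
  IsLeftIdeal B I ∧ I ≠ ⊥ ∧ ∀ J : Submodule ℂ A, IsLeftIdeal B J → J ≤ I → J = ⊥ ∨ J = I

/-- The left socle of the subalgebra `B`: the smallest left ideal of `B` that contains all minimal
left ideals of `B` (the zero ideal if there are none). -/
def socle (B : Submodule ℂ A) : Submodule ℂ A :=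
  sInf {J | IsLeftIdeal B J ∧ ∀ I, IsMinimalLeftIdeal B I → I ≤ J}

end Socle

end LCGroup

/-!
If every left translate `δ_g * μ` of a nonzero measure `μ` in `M(G)` is a scalar multiple of `μ`,
then `G` is compact: translation preserves the total mass of `|μ|`, so that the scalars have modulus
one, and `|μ|` is a finite left Haar measure (`compactSpace_of_leftTranslate`). In each case such a
`μ` is found in a minimal left ideal `I`.

* The augmentation `μ ↦ μ(G)` is multiplicative. If it does not vanish on the socle, then it does
  not vanish on some minimal left ideal `I`, because its kernel is a left ideal. By minimality `I`
  meets the kernel trivially, hence `ν * μ = ν(G) μ` for `μ ∈ I`, and comparing `(δ_g * μ) * μ` with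
  `μ * μ` for `μ ∈ I` with `μ(G) ≠ 0` shows that `μ` is translation-invariant
  (`compactSpace_of_socle`). This covers both `L¹(G)` and `M(G)`.
* If `G` is abelian and `I` is any minimal ideal of `L¹(G)`, then `I = L¹(G) * x` for each nonzero
  `x ∈ I`, since `L¹(G) * x ≠ 0`. So `I` is isomorphic to the quotient of the
  Banach space `L¹(G)` by the closed subspace of all `f` with `f * x = 0`. The translation by `g`
  induces a bounded operator on this quotient, which has a spectral value `c`. The kernel and the
  range of `δ_g - c` on `I` are ideals and `δ_g - c` is not bijective on `I`, so it is zero by the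
  minimality of `I` (`exists_leftTranslate_eq_smul`). This is Schur's lemma with the Gelfand–Mazur
  theorem.

As the product of `M(G)` is defined by its values on compactly supported functions, the
multiplicativity of the augmentation and the associativity of the product rest on the tightness of
regular measures (`mul_spec_of_bound`). That `L¹(G)` is closed under convolution is shown with a
Bochner integral of translates (`ofLp_conv_mem`).
-/

namespace LCGroup

open Filter Topology
open scoped Pointwise ENNReal

/-! ### Integration against a complex measure -/

section Integral

variable {X : Type*} [MeasurableSpace X]

lemma cintegral_const (μ : ComplexMeasure X) (c : ℂ) :
    cintegral μ (fun _ => c) = c * μ Set.univ :=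
  VectorMeasure.integral_const c

lemma cintegral_sub {μ : ComplexMeasure X} {f g : X → ℂ} (hf : Integrable f μ.variation)
    (hg : Integrable g μ.variation) :
    cintegral μ (fun x => f x - g x) = cintegral μ f - cintegral μ g :=
  VectorMeasure.integral_fun_sub hf hg

lemma cintegral_add_measure {μ ν : ComplexMeasure X} {f : X → ℂ}
    (hμ : Integrable f μ.variation) (hν : Integrable f ν.variation) :
    cintegral (μ + ν) f = cintegral μ f + cintegral ν f :=
  VectorMeasure.integral_add_vectorMeasure hμ hν

lemma cintegral_const_mul (μ : ComplexMeasure X) (c : ℂ) (f : X → ℂ) :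
    cintegral μ (fun x => c * f x) = c * cintegral μ f := by
  unfold cintegral
  rw [VectorMeasure.integral_eq_setToFun, VectorMeasure.integral_eq_setToFun]
  exact setToFun_smul _ (fun c s x => mul_assoc c x (μ s)) c f

lemma cintegral_add {μ : ComplexMeasure X} {f g : X → ℂ} (hf : Integrable f μ.variation)
    (hg : Integrable g μ.variation) :
    cintegral μ (fun x => f x + g x) = cintegral μ f + cintegral μ g :=
  VectorMeasure.integral_fun_add hf hg

lemma norm_cintegral_le (μ : ComplexMeasure X) (f : X → ℂ) :
    ‖cintegral μ f‖ ≤ ∫ x, ‖f x‖ ∂μ.variation := by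
  refine (VectorMeasure.norm_integral_le_integral_norm (B := ContinuousLinearMap.mul ℝ ℂ)).trans ?_
  rw [ContinuousLinearMap.opNorm_mul, one_mul]

/-- A function that is at most `a` on a large set `K` and at most `b` elsewhere has a small
integral. -/
lemma norm_cintegral_le_of_bound (μ : ComplexMeasure X) {f : X → ℂ} {K : Set X}
    (hK : MeasurableSet K) {a b : ℝ} (ha : 0 ≤ a) (h1 : ∀ x ∈ K, ‖f x‖ ≤ a)
    (h2 : ∀ x, ‖f x‖ ≤ b) :
    ‖cintegral μ f‖ ≤ a * μ.variation.real Set.univ + b * μ.variation.real Kᶜ := by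
  refine (norm_cintegral_le μ f).trans ?_
  have hi : Integrable (fun x => a + Kᶜ.indicator (fun _ => b) x) μ.variation :=
    (integrable_const a).add ((integrable_const b).indicator hK.compl)
  refine (integral_mono_of_nonneg (.of_forall fun x => norm_nonneg _) hi
    (.of_forall fun x => ?_)).trans (le_of_eq ?_)
  · by_cases hx : x ∈ K
    · simpa [hx] using h1 x hx
    · have := h2 x
      simp only [Set.mem_compl_iff, hx, not_false_eq_true, Set.indicator_of_mem]
      linarith
  · rw [integral_add (integrable_const a) ((integrable_const b).indicator hK.compl),
      integral_const, integral_indicator_const _ hK.compl]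
    simp [mul_comm]

/-- The integral against a complex measure is the only functional on bounded functions that has the
right values on indicators, is additive on simple functions, and satisfies bounded convergence. -/
lemma cintegral_unique {μ : ComplexMeasure X} {Λ : (X → ℂ) → ℂ}
    (hind : ∀ (c : ℂ) (s : Set X), MeasurableSet s → Λ (s.indicator fun _ => c) = c * μ s)
    (hadd : ∀ f g : SimpleFunc X ℂ, Λ (⇑f + ⇑g) = Λ f + Λ g)
    (hlim : ∀ (F : ℕ → SimpleFunc X ℂ) (f : X → ℂ) (C : ℝ), (∀ n x, ‖F n x‖ ≤ C) →
      (∀ x, Tendsto (fun n => F n x) atTop (𝓝 (f x))) →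
      Tendsto (fun n => Λ (F n)) atTop (𝓝 (Λ f)))
    {f : X → ℂ} (hf : StronglyMeasurable f) {C : ℝ} (hC : ∀ x, ‖f x‖ ≤ C) :
    cintegral μ f = Λ f := by
  have hsimple : ∀ f : SimpleFunc X ℂ, cintegral μ f = Λ f := by
    intro f
    induction f using SimpleFunc.induction with
    | const c hs =>
      rename_i s
      have e : ⇑(SimpleFunc.piecewise s hs (SimpleFunc.const X c) (SimpleFunc.const X 0)) =
          s.indicator fun _ => c := by
        ext x
        simp [Set.indicator]
      rw [e, hind c s hs]
      unfold cintegral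
      rw [VectorMeasure.integral_eq_setToFun, setToFun_indicator_const _ hs (measure_ne_top _ _)]
      rfl
    | add _ h1 h2 =>
      rw [SimpleFunc.coe_add, hadd, ← h1, ← h2]
      exact cintegral_add (SimpleFunc.integrable_of_isFiniteMeasure _)
        (SimpleFunc.integrable_of_isFiniteMeasure _)
  have hC0 : ∀ n x, ‖hf.approxBounded (max C 0) n x‖ ≤ max C 0 := fun n x =>
    hf.norm_approxBounded_le (le_max_right _ _) n x
  have ht : ∀ x, Tendsto (fun n => hf.approxBounded (max C 0) n x) atTop (𝓝 (f x)) := fun x =>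
    hf.tendsto_approxBounded_of_norm_le ((hC x).trans (le_max_left _ _))
  have l1 := hlim (hf.approxBounded (max C 0)) f _ hC0 ht
  have l2 : Tendsto (fun n => cintegral μ (hf.approxBounded (max C 0) n)) atTop
      (𝓝 (cintegral μ f)) :=
    VectorMeasure.tendsto_integral_of_dominated_convergence (fun _ => max C 0)
      (fun n => (SimpleFunc.stronglyMeasurable _).aestronglyMeasurable) (integrable_const _)
      (fun n => .of_forall (hC0 n)) (.of_forall ht)
  simp_rw [hsimple] at l2
  exact tendsto_nhds_unique l2 l1

lemma cintegral_smul_measure (μ : ComplexMeasure X) (c : ℂ) {f : X → ℂ}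
    (hf : StronglyMeasurable f) {C : ℝ} (hC : ∀ x, ‖f x‖ ≤ C) :
    cintegral (c • μ) f = c * cintegral μ f := by
  refine cintegral_unique (Λ := fun f => c * cintegral μ f) ?_ ?_ ?_ hf hC
  · intro z s hs
    change c * cintegral μ _ = z * (c * μ s)
    unfold cintegral
    rw [VectorMeasure.integral_eq_setToFun, setToFun_indicator_const _ hs (measure_ne_top _ _)]
    change c * (z * μ s) = _
    ring
  · intro f g
    change c * cintegral μ (fun x => f x + g x) = _
    rw [cintegral_add (SimpleFunc.integrable_of_isFiniteMeasure f)
      (SimpleFunc.integrable_of_isFiniteMeasure g), mul_add]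
  · intro F f C hC ht
    exact (VectorMeasure.tendsto_integral_of_dominated_convergence (fun _ => C)
      (fun n => (SimpleFunc.stronglyMeasurable _).aestronglyMeasurable) (integrable_const _)
      (fun n => .of_forall (hC n)) (.of_forall ht)).const_mul c

lemma cintegral_withDensity {m : Measure X} {g : X → ℂ} (hg : Integrable g m) {f : X → ℂ}
    (hf : StronglyMeasurable f) {C : ℝ} (hC : ∀ x, ‖f x‖ ≤ C) :
    cintegral (m.withDensityᵥ g) f = ∫ x, f x * g x ∂m := by
  have hint : ∀ f : SimpleFunc X ℂ, Integrable (fun x => f x * g x) m := fun f => by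
    obtain ⟨C, hC⟩ := f.exists_forall_norm_le
    exact hg.bdd_mul f.stronglyMeasurable.aestronglyMeasurable (.of_forall hC)
  refine cintegral_unique (Λ := fun f => ∫ x, f x * g x ∂m) ?_ ?_ ?_ hf hC
  · intro c s hs
    rw [withDensityᵥ_apply hg hs, ← integral_const_mul, ← integral_indicator hs]
    refine integral_congr_ae (.of_forall fun x => ?_)
    by_cases hx : x ∈ s <;> simp [hx]
  · intro f₁ f₂
    rw [← integral_add (hint f₁) (hint f₂)]
    exact integral_congr_ae (.of_forall fun x => add_mul _ _ _)
  · intro F f C hC ht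
    refine tendsto_integral_of_dominated_convergence (fun x => C * ‖g x‖)
      (fun n => (hint (F n)).aestronglyMeasurable) (hg.norm.const_mul C) (fun n => ?_)
      (.of_forall fun x => (ht x).mul_const _)
    refine .of_forall fun x => ?_
    rw [norm_mul]
    exact mul_le_mul_of_nonneg_right (hC n x) (norm_nonneg _)

end Integral

/-! ### Integrals of bounded continuous functions and the convolution product -/

section Bounded

lemma integrable_of_bound {X : Type*} [TopologicalSpace X] [MeasurableSpace X] [BorelSpace X]
    (p : Measure X) [IsFiniteMeasure p] {h : X → ℂ} (hh : Continuous h) {C : ℝ}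
    (hC : ∀ x, ‖h x‖ ≤ C) : Integrable h p :=
  .of_bound hh.aestronglyMeasurable C (.of_forall hC)

lemma exists_bound {X : Type*} [TopologicalSpace X] (f : C_c(X, ℂ)) :
    ∃ C, 0 ≤ C ∧ ∀ x, ‖f x‖ ≤ C := by
  obtain ⟨C, hC⟩ := f.hasCompactSupport.exists_bound_of_continuous f.continuous
  exact ⟨max C 0, le_max_right _ _, fun x => (hC x).trans (le_max_left _ _)⟩

lemma norm_cintegral_translate_le {G : Type*} [Mul G] [MeasurableSpace G] (ν : ComplexMeasure G)
    {h : G → ℂ} {C : ℝ} (hC0 : 0 ≤ C) (hC : ∀ x, ‖h x‖ ≤ C) (x : G) :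
    ‖cintegral ν fun y => h (x * y)‖ ≤ C * ν.variation.real Set.univ := by
  simpa using norm_cintegral_le_of_bound ν MeasurableSet.univ hC0 (fun y _ => hC (x * y))
    fun y => hC (x * y)

variable {G : Type*} [TopologicalSpace G] [T2Space G] [MeasurableSpace G] [BorelSpace G]

/-- A regular complex measure is concentrated on a compact set, up to `ε`. -/
lemma exists_isCompact_variation_compl_lt (μ : MeasureAlgebra G) {ε : ℝ} (hε : 0 < ε) :
    ∃ K : Set G, IsCompact K ∧ (μ : ComplexMeasure G).variation.real Kᶜ < ε := by
  have : (μ : ComplexMeasure G).variation.Regular := μ.2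
  obtain ⟨K, -, hK, h⟩ := MeasurableSet.univ.exists_isCompact_sdiff_lt
    (measure_ne_top (μ : ComplexMeasure G).variation Set.univ) (ENNReal.ofReal_pos.2 hε).ne'
  refine ⟨K, hK, ?_⟩
  rw [← Set.compl_eq_univ_sdiff] at h
  exact (ENNReal.lt_ofReal_iff_toReal_lt (measure_ne_top _ _)).1 h

lemma ext_of_cintegral [LocallyCompactSpace G] {μ ν : MeasureAlgebra G}
    (h : ∀ f : C_c(G, ℂ), cintegral (μ : ComplexMeasure G) f = cintegral (ν : ComplexMeasure G) f) :
    μ = ν := by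
  refine Subtype.ext (sub_eq_zero.1 (eq_zero_of_cintegral (Submodule.sub_mem _ μ.2 ν.2)
    fun f => ?_))
  have := VectorMeasure.integral_sub_vectorMeasure (B := ContinuousLinearMap.mul ℝ ℂ)
    (integrable_of_compactSupport (μ : ComplexMeasure G).variation f)
    (integrable_of_compactSupport (ν : ComplexMeasure G).variation f)
  exact this.trans (sub_eq_zero.2 (h f))

variable [Group G] [IsTopologicalGroup G]

/-- The function `h` need not be uniformly continuous on `G`: by the tightness of `ν` it is enough
that `h (x * y)` is close to `h (x₀ * y)` uniformly in `y` in a compact set. -/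
lemma continuous_cintegral_translate (ν : MeasureAlgebra G) {h : G → ℂ} (hh : Continuous h)
    {C : ℝ} (hC : ∀ x, ‖h x‖ ≤ C) :
    Continuous fun x => cintegral (ν : ComplexMeasure G) fun y => h (x * y) := by
  have hC0 : 0 ≤ C := (norm_nonneg _).trans (hC 1)
  set N := (ν : ComplexMeasure G).variation
  have hint : ∀ x, Integrable (fun y => h (x * y)) N := fun x =>
    integrable_of_bound N (hh.comp (continuous_const_mul x)) fun y => hC _
  refine continuous_iff_continuousAt.2 fun x₀ => Metric.continuousAt_iff'.2 fun ε hε => ?_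
  obtain ⟨δ, hδ, hδε⟩ : ∃ δ > 0, δ * (N.real Set.univ + 2 * C) < ε := by
    refine ⟨ε / (N.real Set.univ + 2 * C + 1), by positivity, ?_⟩
    rw [div_mul_eq_mul_div, div_lt_iff₀ (by positivity)]
    nlinarith [measureReal_nonneg (μ := N) (s := Set.univ)]
  obtain ⟨K, hK, hKδ⟩ := exists_isCompact_variation_compl_lt ν hδ
  have hnear : ∀ᶠ x in 𝓝 x₀, ∀ y ∈ K, dist (h (x * y)) (h (x₀ * y)) < δ := by
    refine hK.eventually_forall_of_forall_eventually fun y _ => ?_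
    have hc : Continuous fun z : G × G => dist (h (z.1 * z.2)) (h (x₀ * z.2)) := by fun_prop
    exact hc.continuousAt.eventually_lt continuousAt_const (by simpa using hδ)
  filter_upwards [hnear] with x hx
  rw [dist_eq_norm, ← cintegral_sub (hint x) (hint x₀)]
  refine (norm_cintegral_le_of_bound (ν : ComplexMeasure G) hK.measurableSet hδ.le
    (b := 2 * C) (fun y hy => ?_) fun y => ?_).trans_lt ?_
  · rw [← dist_eq_norm]
    exact (hx y hy).le
  · refine (norm_sub_le _ _).trans ?_
    linarith [hC (x * y), hC (x₀ * y)]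
  · nlinarith [hC0]

variable [LocallyCompactSpace G]

/-- The defining formula for `μ * ν` holds for all bounded continuous functions, because all the
measures are tight. -/
lemma mul_spec_of_bound (μ ν : MeasureAlgebra G) {h : G → ℂ} (hh : Continuous h) {C : ℝ}
    (hC : ∀ x, ‖h x‖ ≤ C) :
    cintegral ((μ * ν : MeasureAlgebra G) : ComplexMeasure G) h =
      cintegral (μ : ComplexMeasure G) fun x =>
        cintegral (ν : ComplexMeasure G) fun y => h (x * y) := by
  have hC0 : 0 ≤ C := (norm_nonneg _).trans (hC 1)
  set M := (μ : ComplexMeasure G).variation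
  set N := (ν : ComplexMeasure G).variation
  set P := ((μ * ν : MeasureAlgebra G) : ComplexMeasure G).variation
  have key : ∀ δ > 0, ‖cintegral ((μ * ν : MeasureAlgebra G) : ComplexMeasure G) h -
      cintegral (μ : ComplexMeasure G) fun x =>
        cintegral (ν : ComplexMeasure G) fun y => h (x * y)‖ ≤
      δ * (C + C * M.real Set.univ + C * N.real Set.univ) := by
    intro δ hδ
    obtain ⟨K₁, hK₁, hδ₁⟩ := exists_isCompact_variation_compl_lt μ hδ
    obtain ⟨K₂, hK₂, hδ₂⟩ := exists_isCompact_variation_compl_lt ν hδ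
    obtain ⟨K₃, hK₃, hδ₃⟩ := exists_isCompact_variation_compl_lt (μ * ν) hδ
    -- The cutoff `φ` is `1` at `x * y` for `x ∈ K₁` and `y ∈ K₂`, and on `K₃`, so that replacing
    -- `h` by `φ h` costs `O(δ)` on both sides.
    obtain ⟨φ, hφ1, hφc, hφ⟩ := exists_continuousMap_one_of_isCompact_subset_isOpen
      ((hK₁.mul hK₂).union hK₃) isOpen_univ (Set.subset_univ _)
    have hφI : ∀ x, φ x ∈ Set.Icc (0 : ℝ) 1 := fun x => hφ.2 x
    have hcs : HasCompactSupport φ := hφc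
    have hφone : ∀ x ∈ K₁ * K₂ ∪ K₃, φ x = 1 := fun x hx => hφ1 hx
    let g : C_c(G, ℂ) := ⟨⟨fun x => φ x * h x,
      (Complex.continuous_ofReal.comp φ.continuous).mul hh⟩,
      (hcs.comp_left (g := ((↑) : ℝ → ℂ)) Complex.ofReal_zero).mul_right⟩
    have hgC : ∀ x, ‖g x‖ ≤ C := fun x => by
      change ‖(φ x : ℂ) * h x‖ ≤ C
      rw [norm_mul, Complex.norm_real, Real.norm_of_nonneg (hφI x).1]
      nlinarith [(hφI x).1, (hφI x).2, hC x, norm_nonneg (h x)]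
    have hd : ∀ x, ‖h x - g x‖ ≤ C := fun x => by
      have : h x - g x = ((1 - φ x : ℝ) : ℂ) * h x := by
        change h x - (φ x : ℂ) * h x = _
        push_cast
        ring
      rw [this, norm_mul, Complex.norm_real, Real.norm_of_nonneg (by linarith [(hφI x).2])]
      nlinarith [(hφI x).1, (hφI x).2, hC x, norm_nonneg (h x)]
    have hd0 : ∀ x ∈ K₁ * K₂ ∪ K₃, ‖h x - g x‖ ≤ 0 := fun x hx => by
      have : g x = φ x * h x := rfl
      rw [this, hφone x hx]
      simp
    have e1 : cintegral ((μ * ν : MeasureAlgebra G) : ComplexMeasure G) h -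
        cintegral ((μ * ν : MeasureAlgebra G) : ComplexMeasure G) g =
        cintegral ((μ * ν : MeasureAlgebra G) : ComplexMeasure G) fun x => h x - g x :=
      (cintegral_sub (integrable_of_bound P hh hC)
        (integrable_of_bound P (map_continuous g) hgC)).symm
    have e2 : (cintegral (μ : ComplexMeasure G) fun x =>
          cintegral (ν : ComplexMeasure G) fun y => h (x * y)) -
        (cintegral (μ : ComplexMeasure G) fun x =>
          cintegral (ν : ComplexMeasure G) fun y => g (x * y)) =
        cintegral (μ : ComplexMeasure G) fun x =>
          cintegral (ν : ComplexMeasure G) fun y => h (x * y) - g (x * y) := by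
      rw [← cintegral_sub (integrable_of_bound M (continuous_cintegral_translate ν hh hC)
          (norm_cintegral_translate_le _ hC0 hC))
        (integrable_of_bound M (continuous_cintegral_translate ν (map_continuous g) hgC)
          (norm_cintegral_translate_le _ hC0 hgC))]
      congr 1
      funext x
      exact (cintegral_sub
        (integrable_of_bound N (hh.comp (continuous_const_mul x)) fun y => hC _)
        (integrable_of_bound N ((map_continuous g).comp (continuous_const_mul x))
          fun y => hgC _)).symm
    have b1 := norm_cintegral_le_of_bound ((μ * ν : MeasureAlgebra G) : ComplexMeasure G)
      hK₃.measurableSet le_rfl (fun x hx => hd0 x (Or.inr hx)) hd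
    have b2 := norm_cintegral_le_of_bound (μ : ComplexMeasure G)
      (f := fun x => cintegral (ν : ComplexMeasure G) fun y => h (x * y) - g (x * y))
      hK₁.measurableSet (a := C * δ) (b := C * N.real Set.univ) (by positivity)
      (fun x hx => by
        refine (norm_cintegral_le_of_bound (ν : ComplexMeasure G) hK₂.measurableSet le_rfl
          (fun y hy => hd0 _ (Or.inl (Set.mul_mem_mul hx hy))) fun y => hd _).trans ?_
        rw [zero_mul, zero_add]
        exact mul_le_mul_of_nonneg_left hδ₂.le hC0)
      (fun x => norm_cintegral_translate_le (ν : ComplexMeasure G) (h := fun x => h x - g x)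
        hC0 hd x)
    have e3 := mul_spec μ ν g
    have e4 : ∀ a b c d : ℂ, c = d → a - b = (a - c) - (b - d) := by
      rintro a b c d rfl
      ring
    rw [e4 _ _ _ _ e3, e1, e2]
    refine (norm_sub_le _ _).trans ((add_le_add b1 b2).trans ?_)
    have hN0 : 0 ≤ C * N.real Set.univ := by positivity
    have c1 := mul_le_mul_of_nonneg_left hδ₃.le hC0
    have c2 := mul_le_mul_of_nonneg_left hδ₁.le hN0
    rw [zero_mul, zero_add]
    refine (add_le_add c1 (add_le_add le_rfl c2)).trans (le_of_eq ?_)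
    ring
  rw [← sub_eq_zero, ← norm_le_zero_iff]
  refine ge_of_tendsto (x := 𝓝[>] (0 : ℝ)) ?_ (eventually_nhdsWithin_of_forall key)
  refine Tendsto.mono_left ?_ nhdsWithin_le_nhds
  exact (continuous_id.mul continuous_const).tendsto' 0 0 (by simp)

lemma mul_apply_univ (μ ν : MeasureAlgebra G) :
    ((μ * ν : MeasureAlgebra G) : ComplexMeasure G) Set.univ =
      (μ : ComplexMeasure G) Set.univ * (ν : ComplexMeasure G) Set.univ := by
  have := mul_spec_of_bound μ ν (h := fun _ => 1) continuous_const (C := 1) (by simp)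
  simpa [cintegral_const, mul_comm] using this

lemma conv_assoc (μ ν ρ : MeasureAlgebra G) : μ * ν * ρ = μ * (ν * ρ) := by
  refine ext_of_cintegral fun f => ?_
  obtain ⟨C, hC0, hC⟩ := exists_bound f
  rw [mul_spec, mul_spec, mul_spec_of_bound μ ν
    (continuous_cintegral_translate ρ (map_continuous f) hC)
    (norm_cintegral_translate_le _ hC0 hC)]
  congr 1
  ext x
  simp_rw [mul_assoc]
  exact (mul_spec_of_bound ν ρ ((map_continuous f).comp (continuous_const_mul x))
    fun y => hC _).symm

lemma conv_add (μ ν ρ : MeasureAlgebra G) : μ * (ν + ρ) = μ * ν + μ * ρ := by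
  refine ext_of_cintegral fun f => ?_
  obtain ⟨C, hC0, hC⟩ := exists_bound f
  rw [Submodule.coe_add, cintegral_add_measure (integrable_of_compactSupport _ f)
    (integrable_of_compactSupport _ f), mul_spec, mul_spec, mul_spec,
    ← cintegral_add (integrable_of_bound _ (continuous_cintegral_translate ν (map_continuous f) hC)
        (norm_cintegral_translate_le _ hC0 hC))
      (integrable_of_bound _ (continuous_cintegral_translate ρ (map_continuous f) hC)
        (norm_cintegral_translate_le _ hC0 hC))]
  congr 1
  ext x
  exact cintegral_add_measure (integrable_of_compactSupport _ (translate f x))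
    (integrable_of_compactSupport _ (translate f x))

lemma add_conv (μ ν ρ : MeasureAlgebra G) : (μ + ν) * ρ = μ * ρ + ν * ρ := by
  refine ext_of_cintegral fun f => ?_
  obtain ⟨C, hC0, hC⟩ := exists_bound f
  have hi : ∀ p : Measure G, IsFiniteMeasure p → Integrable
      (fun x => cintegral (ρ : ComplexMeasure G) fun y => f (x * y)) p := fun p _ =>
    integrable_of_bound _ (continuous_cintegral_translate ρ (map_continuous f) hC)
      (norm_cintegral_translate_le _ hC0 hC)
  rw [Submodule.coe_add, cintegral_add_measure (integrable_of_compactSupport _ f)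
    (integrable_of_compactSupport _ f), mul_spec, mul_spec, mul_spec, Submodule.coe_add,
    cintegral_add_measure (hi _ inferInstance) (hi _ inferInstance)]

lemma conv_smul (c : ℂ) (μ ν : MeasureAlgebra G) : μ * (c • ν) = c • (μ * ν) := by
  refine ext_of_cintegral fun f => ?_
  obtain ⟨C, hC0, hC⟩ := exists_bound f
  rw [Submodule.coe_smul, cintegral_smul_measure _ _ (map_continuous f).stronglyMeasurable hC,
    mul_spec, mul_spec, ← cintegral_const_mul]
  congr 1
  ext x
  exact cintegral_smul_measure _ _ (map_continuous (translate f x)).stronglyMeasurable fun y => hC _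

lemma smul_conv (c : ℂ) (μ ν : MeasureAlgebra G) : (c • μ) * ν = c • (μ * ν) := by
  refine ext_of_cintegral fun f => ?_
  obtain ⟨C, hC0, hC⟩ := exists_bound f
  rw [Submodule.coe_smul, cintegral_smul_measure _ _ (map_continuous f).stronglyMeasurable hC,
    mul_spec, mul_spec, Submodule.coe_smul, cintegral_smul_measure _ _
      (continuous_cintegral_translate ν (map_continuous f) hC).stronglyMeasurable
      (norm_cintegral_translate_le _ hC0 hC)]

end Bounded

/-! ### Left translation of measures -/

section Translation

variable {G : Type*} [TopologicalSpace G] [T2Space G] [MeasurableSpace G] [BorelSpace G]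
  [Group G] [IsTopologicalGroup G]

/-- The left translation `μ ↦ δ_g * μ` of `M(G)`, as the image under `x ↦ g x`. -/
noncomputable def leftTranslate (g : G) : MeasureAlgebra G →ₗ[ℂ] MeasureAlgebra G where
  toFun μ := ⟨(μ : ComplexMeasure G).map (g * ·), by
    have : (μ : ComplexMeasure G).variation.Regular := μ.2
    change Measure.Regular (VectorMeasure.variation _)
    rw [(measurableEmbedding_mulLeft g).variation_map]
    exact Measure.Regular.map (Homeomorph.mulLeft g)⟩
  map_add' μ ν := by
    ext s hs
    simp [VectorMeasure.map_apply _ (measurable_const_mul g) hs]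
  map_smul' c μ := by
    ext s hs
    simp [VectorMeasure.map_apply _ (measurable_const_mul g) hs]

lemma leftTranslate_apply (g : G) (μ : MeasureAlgebra G) {s : Set G} (hs : MeasurableSet s) :
    (leftTranslate g μ : ComplexMeasure G) s = (μ : ComplexMeasure G) ((g * ·) ⁻¹' s) :=
  VectorMeasure.map_apply _ (measurable_const_mul g) hs

lemma variation_leftTranslate (g : G) (μ : MeasureAlgebra G) :
    (leftTranslate g μ : ComplexMeasure G).variation =
      (μ : ComplexMeasure G).variation.map (g * ·) :=
  (measurableEmbedding_mulLeft g).variation_map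

lemma cintegral_leftTranslate (g : G) (μ : MeasureAlgebra G) (f : G → ℂ) :
    cintegral (leftTranslate g μ : ComplexMeasure G) f =
      cintegral (μ : ComplexMeasure G) fun x => f (g * x) :=
  (measurableEmbedding_mulLeft g).integral_map_vectorMeasure

variable [LocallyCompactSpace G]

lemma leftTranslate_conv (g : G) (μ ν : MeasureAlgebra G) :
    leftTranslate g μ * ν = leftTranslate g (μ * ν) := by
  refine ext_of_cintegral fun f => ?_
  rw [mul_spec, cintegral_leftTranslate, cintegral_leftTranslate]
  refine Eq.trans ?_ (mul_spec μ ν (translate f g)).symm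
  simp_rw [mul_assoc]
  rfl

lemma conv_leftTranslate (hG : ∀ x y : G, x * y = y * x) (g : G) (μ ν : MeasureAlgebra G) :
    μ * leftTranslate g ν = leftTranslate g (μ * ν) := by
  refine ext_of_cintegral fun f => ?_
  rw [mul_spec, cintegral_leftTranslate]
  refine Eq.trans ?_ (mul_spec μ ν (translate f g)).symm
  congr 1
  ext x
  rw [cintegral_leftTranslate]
  congr 1
  ext y
  change f (x * (g * y)) = f (g * (x * y))
  rw [← mul_assoc, hG x g, mul_assoc]

/-- If all translates of `μ ≠ 0` are multiples of `μ`, then `|μ|` is a finite left Haar measure: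
the factors have modulus one, as translation preserves the total mass of `|μ|`. -/
lemma compactSpace_of_leftTranslate {μ : MeasureAlgebra G} (hμ : μ ≠ 0)
    (h : ∀ g : G, ∃ c : ℂ, leftTranslate g μ = c • μ) : CompactSpace G := by
  have : (μ : ComplexMeasure G).variation.Regular := μ.2
  set M := (μ : ComplexMeasure G).variation with hM
  have hM0 : M ≠ 0 := fun h0 => hμ <| Subtype.ext <| by
    ext s hs
    have := VectorMeasure.norm_measure_le_variation (μ := (μ : ComplexMeasure G)) (E := s)
      (measure_ne_top _ _)
    rw [← hM, h0] at this
    simpa using this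
  have : NeZero M := ⟨hM0⟩
  have : M.IsMulLeftInvariant := ⟨fun g => by
    obtain ⟨c, hc⟩ := h g
    have h1 : M.map (g * ·) = ‖c‖₊ • M := by
      rw [← variation_leftTranslate, hc, Submodule.coe_smul, VectorMeasure.variation_smul]
    have h2 : M Set.univ = ‖c‖₊ * M Set.univ := by
      have := congrArg (fun p : Measure G => p Set.univ) h1
      simpa [Measure.map_apply (measurable_const_mul g) MeasurableSet.univ] using this
    have h3 : ‖c‖₊ = 1 := by
      have := (ENNReal.mul_eq_right (by simpa using hM0) (measure_ne_top M _)).1 h2.symm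
      exact_mod_cast this
    rw [h1, h3, one_smul]⟩
  by_contra hc
  have : NoncompactSpace G := not_compactSpace_iff.1 hc
  exact measure_ne_top M _ (measure_univ_of_isMulLeftInvariant M)

end Translation

/-! ### The group algebra as the image of a Banach space -/

section GroupAlgebra

/-- The indefinite integral of an integrable function with respect to a regular measure is inner
regular, although the measure need not be `σ`-finite. -/
lemma exists_isCompact_setLIntegral_lt {X : Type*} [TopologicalSpace X] [T2Space X]
    [MeasurableSpace X] [BorelSpace X] {m : Measure X} [m.Regular] {g : X → ℂ}
    (hg : Integrable g m) {A : Set X} (hA : MeasurableSet A) {ε : ℝ≥0∞} (hε : ε ≠ 0) :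
    ∃ K ⊆ A, IsCompact K ∧ ∫⁻ x in A \ K, ‖g x‖ₑ ∂m < ε := by
  have hε2 : ε / 2 ≠ 0 := by simpa using hε
  -- Outside the support `S` of an approximating simple function, `g` has a small integral.
  obtain ⟨f, hf, hfm⟩ := (memLp_one_iff_integrable.2 hg).exists_simpleFunc_eLpNorm_sub_lt
    ENNReal.one_ne_top hε2
  set S := Function.support f with hS
  have hSm : MeasurableSet S := f.measurableSet_support
  have hSfin : m S < ∞ := SimpleFunc.measure_support_lt_top_of_memLp f hfm one_ne_zero
    ENNReal.one_ne_top
  obtain ⟨δ, hδ, hlt⟩ := exists_pos_setLIntegral_lt_of_measure_lt hg.2.ne hε2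
  obtain ⟨K, hKA, hK, hKδ⟩ := (hA.inter hSm).exists_isCompact_sdiff_lt
    ((measure_mono Set.inter_subset_right).trans_lt hSfin).ne hδ.ne'
  refine ⟨K, hKA.trans Set.inter_subset_left, hK, ?_⟩
  have hsub : A \ K ⊆ Sᶜ ∪ ((A ∩ S) \ K) := by
    intro x hx
    by_cases hxS : x ∈ S
    · exact Or.inr ⟨⟨hx.1, hxS⟩, hx.2⟩
    · exact Or.inl hxS
  have h1 : ∫⁻ x in Sᶜ, ‖g x‖ₑ ∂m ≤ ∫⁻ x, ‖g x - f x‖ₑ ∂m := by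
    refine le_trans (le_of_eq ?_) (setLIntegral_le_lintegral Sᶜ _)
    refine setLIntegral_congr_fun hSm.compl fun x hx => ?_
    have : f x = 0 := by simpa [hS] using hx
    simp [this]
  rw [eLpNorm_one_eq_lintegral_enorm] at hf
  calc ∫⁻ x in A \ K, ‖g x‖ₑ ∂m
      ≤ ∫⁻ x in Sᶜ ∪ ((A ∩ S) \ K), ‖g x‖ₑ ∂m := lintegral_mono_set hsub
    _ ≤ ∫⁻ x in Sᶜ, ‖g x‖ₑ ∂m + ∫⁻ x in (A ∩ S) \ K, ‖g x‖ₑ ∂m := lintegral_union_le _ _ _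
    _ < ε / 2 + ε / 2 := ENNReal.add_lt_add (h1.trans_lt hf) (hlt _ hKδ)
    _ = ε := ENNReal.add_halves ε

lemma variation_withDensity_le {X : Type*} [MeasurableSpace X] {m : Measure X} {g : X → ℂ}
    (hg : Integrable g m) {s : Set X} (hs : MeasurableSet s) :
    (m.withDensityᵥ g).variation s ≤ ∫⁻ x in s, ‖g x‖ₑ ∂m := by
  rw [← withDensity_apply _ hs]
  refine (VectorMeasure.variation_le_of_forall_enorm_le (m := m.withDensity fun x => ‖g x‖ₑ)
    fun t ht => ?_) s
  rw [withDensityᵥ_apply hg ht, withDensity_apply _ ht]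
  exact enorm_integral_le_lintegral_enorm _

lemma regular_withDensity {X : Type*} [TopologicalSpace X] [T2Space X]
    [MeasurableSpace X] [BorelSpace X] {m : Measure X} [m.Regular] {g : X → ℂ}
    (hg : Integrable g m) : (m.withDensityᵥ g).variation.Regular := by
  set p := (m.withDensityᵥ g).variation
  have : p.InnerRegular := by
    constructor
    intro A hA r hr
    obtain ⟨ε, hε, hr'⟩ : ∃ ε : ℝ≥0∞, ε ≠ 0 ∧ r + ε < p A := by
      obtain ⟨ε, hε, h'⟩ := ENNReal.lt_iff_exists_add_pos_lt.1 hr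
      exact ⟨ε, by exact_mod_cast hε.ne', h'⟩
    obtain ⟨K, hKA, hK, hlt⟩ := exists_isCompact_setLIntegral_lt hg hA hε
    refine ⟨K, hKA, hK, ?_⟩
    have h1 : p A ≤ p K + p (A \ K) := by
      rw [measure_add_sdiff hK.measurableSet.nullMeasurableSet]
      exact measure_mono Set.subset_union_right
    have h2 : p (A \ K) ≤ ε :=
      (variation_withDensity_le hg (hA.diff hK.measurableSet)).trans hlt.le
    by_contra! h3
    exact absurd (hr'.trans_le (h1.trans (add_le_add h3 h2))) (lt_irrefl _)
  infer_instance

variable {G : Type*} [TopologicalSpace G] [MeasurableSpace G] [BorelSpace G] [Group G]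
  [IsTopologicalGroup G] [LocallyCompactSpace G]

/-- Left translation by `g` on `L¹(G)`. -/
noncomputable def translateLp (g : G) :
    Lp ℂ 1 (Measure.haar : Measure G) →L[ℂ] Lp ℂ 1 (Measure.haar : Measure G) :=
  (Lp.compMeasurePreservingₗᵢ ℂ (g⁻¹ * ·)
    (measurePreserving_mul_left Measure.haar g⁻¹)).toContinuousLinearMap

lemma coeFn_translateLp (g : G) (f : Lp ℂ 1 (Measure.haar : Measure G)) :
    translateLp g f =ᵐ[Measure.haar] fun x => f (g⁻¹ * x) :=
  Lp.coeFn_compMeasurePreserving f (measurePreserving_mul_left Measure.haar g⁻¹)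

lemma continuous_translateLp (f : Lp ℂ 1 (Measure.haar : Measure G)) :
    Continuous fun g : G => translateLp g f := by
  have : Fact ((1 : ℝ≥0∞) ≠ ∞) := ⟨ENNReal.one_ne_top⟩
  change Continuous fun g : G => DomMulAct.mk g⁻¹ • f
  have h : Continuous fun g : G => DomMulAct.mk g⁻¹ :=
    DomMulAct.continuous_mk.comp continuous_inv
  exact h.smul continuous_const

variable [T2Space G]

variable (G) in
/-- The embedding `f ↦ f dλ` of the Banach space `L¹(G)` into `M(G)`. -/
noncomputable def ofLp : Lp ℂ 1 (Measure.haar : Measure G) →ₗ[ℂ] MeasureAlgebra G where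
  toFun f := ⟨Measure.haar.withDensityᵥ f, regular_withDensity (L1.integrable_coeFn f)⟩
  map_add' f g := Subtype.ext <| by
    change _ = Measure.haar.withDensityᵥ f + Measure.haar.withDensityᵥ g
    rw [← withDensityᵥ_add (L1.integrable_coeFn f) (L1.integrable_coeFn g)]
    exact WithDensityᵥEq.congr_ae (Lp.coeFn_add f g)
  map_smul' c f := Subtype.ext <| by
    change _ = c • Measure.haar.withDensityᵥ f
    rw [← withDensityᵥ_smul]
    exact WithDensityᵥEq.congr_ae (Lp.coeFn_smul c f)

lemma coe_ofLp (f : Lp ℂ 1 (Measure.haar : Measure G)) :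
    (ofLp G f : ComplexMeasure G) = Measure.haar.withDensityᵥ f := rfl

lemma range_ofLp : LinearMap.range (ofLp G) = groupAlgebra G := by
  ext μ
  constructor
  · rintro ⟨f, rfl⟩
    exact ⟨f, L1.integrable_coeFn f, rfl⟩
  · rintro ⟨f, hf, h⟩
    exact ⟨hf.toL1 f, Subtype.ext (by
      rw [h, coe_ofLp]; exact WithDensityᵥEq.congr_ae hf.coeFn_toL1)⟩

lemma cintegral_ofLp (f : Lp ℂ 1 (Measure.haar : Measure G)) {h : G → ℂ} (hh : Continuous h)
    {C : ℝ} (hC : ∀ x, ‖h x‖ ≤ C) :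
    cintegral (ofLp G f : ComplexMeasure G) h = ∫ x, h x * f x ∂Measure.haar :=
  cintegral_withDensity (L1.integrable_coeFn f) hh.stronglyMeasurable hC

/-- Integration against a bounded continuous function `h`, as a continuous functional on `L¹(G)`.
The bound `C` for `h` only serves to bound the norm of the functional. -/
noncomputable def pairing (h : G → ℂ) (hh : Continuous h) (C : ℝ) (hC : ∀ x, ‖h x‖ ≤ C) :
    Lp ℂ 1 (Measure.haar : Measure G) →L[ℂ] ℂ :=
  have hi : ∀ f : Lp ℂ 1 (Measure.haar : Measure G),
      Integrable (fun x => h x * f x) (Measure.haar : Measure G) := fun f =>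
    (L1.integrable_coeFn f).bdd_mul hh.aestronglyMeasurable (.of_forall hC)
  LinearMap.mkContinuous
    { toFun := fun f => ∫ x, h x * f x ∂Measure.haar
      map_add' := fun f g => by
        rw [← integral_add (hi f) (hi g)]
        refine integral_congr_ae ?_
        filter_upwards [Lp.coeFn_add f g] with x hx
        rw [hx, Pi.add_apply, mul_add]
      map_smul' := fun c f => by
        rw [RingHom.id_apply, smul_eq_mul, ← integral_const_mul]
        refine integral_congr_ae ?_
        filter_upwards [Lp.coeFn_smul c f] with x hx
        rw [hx, Pi.smul_apply, smul_eq_mul, mul_left_comm] }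
    C fun f => by
      rw [L1.norm_eq_integral_norm, ← integral_const_mul]
      refine norm_integral_le_of_norm_le ((L1.integrable_coeFn f).norm.const_mul C)
        (.of_forall fun x => ?_)
      rw [norm_mul]
      exact mul_le_mul_of_nonneg_right (hC x) (norm_nonneg _)

lemma pairing_apply {h : G → ℂ} (hh : Continuous h) {C : ℝ} (hC : ∀ x, ‖h x‖ ≤ C)
    (f : Lp ℂ 1 (Measure.haar : Measure G)) :
    pairing h hh C hC f = cintegral (ofLp G f : ComplexMeasure G) h :=
  (cintegral_ofLp f hh hC).symm

lemma ofLp_translateLp (g : G) (f : Lp ℂ 1 (Measure.haar : Measure G)) :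
    ofLp G (translateLp g f) = leftTranslate g (ofLp G f) := by
  refine Subtype.ext ?_
  ext s hs
  have hf := L1.integrable_coeFn f
  have hm := measurePreserving_mul_left (Measure.haar : Measure G) g
  rw [leftTranslate_apply g _ hs, coe_ofLp, coe_ofLp,
    withDensityᵥ_apply (L1.integrable_coeFn _) hs,
    withDensityᵥ_apply hf (measurable_const_mul g hs),
    setIntegral_congr_ae hs ((coeFn_translateLp g f).mono fun x hx _ => hx),
    ← hm.setIntegral_preimage_emb (measurableEmbedding_mulLeft g)]
  simp

lemma leftTranslate_mem_groupAlgebra (g : G) {μ : MeasureAlgebra G} (hμ : μ ∈ groupAlgebra G) :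
    leftTranslate g μ ∈ groupAlgebra G := by
  rw [← range_ofLp] at hμ ⊢
  obtain ⟨f, rfl⟩ := hμ
  exact ⟨translateLp g f, ofLp_translateLp g f⟩

lemma integrable_smul_translateLp {b : G → ℂ} (hb : Integrable b Measure.haar)
    (a : Lp ℂ 1 (Measure.haar : Measure G)) :
    Integrable (fun s => b s • translateLp s a) Measure.haar := by
  have hT := continuous_translateLp a
  have hmeas : AEStronglyMeasurable (fun s => b s • translateLp s a)
      (Measure.haar : Measure G) := by
    -- The values of `s ↦ translateLp s a` need not lie in a separable set, but they do for `s`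
    -- in a compact set, and `b` is a limit of functions that vanish outside compact sets.
    choose K _ hK hle using fun n : ℕ =>
      exists_isCompact_setLIntegral_lt hb MeasurableSet.univ (ε := ((n : ℝ≥0∞) + 1)⁻¹) (by simp)
    have hKm : ∀ n, MeasurableSet (K n) := fun n => (hK n).measurableSet
    have hlim : Tendsto (fun n => eLpNorm ((K n).indicator b - b) 1 Measure.haar) atTop
        (𝓝 0) := by
      refine tendsto_of_tendsto_of_tendsto_of_le_of_le tendsto_const_nhds
        (ENNReal.tendsto_inv_nat_nhds_zero.comp (tendsto_add_atTop_nat 1))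
        (fun n => zero_le) fun n => ?_
      have e : (K n).indicator b - b = -(K n)ᶜ.indicator b := by
        rw [Set.indicator_compl]
        abel
      rw [e, eLpNorm_neg, eLpNorm_indicator_eq_eLpNorm_restrict (hKm n).compl,
        eLpNorm_one_eq_lintegral_enorm]
      simpa [← Set.compl_eq_univ_sdiff] using (hle n).le
    obtain ⟨ns, -, hns⟩ := (tendstoInMeasure_of_tendsto_eLpNorm one_ne_zero
      (fun n => hb.aestronglyMeasurable.indicator (hKm n)) hb.aestronglyMeasurable
      hlim).exists_seq_tendsto_ae
    refine aestronglyMeasurable_of_tendsto_ae atTop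
      (f := fun n s => (K (ns n)).indicator b s • translateLp s a) (fun n => ?_) ?_
    · have e : (fun s => (K (ns n)).indicator b s • translateLp s a) =
          (K (ns n)).indicator fun s => b s • translateLp s a := by
        ext1 s
        by_cases hs : s ∈ K (ns n) <;> simp [hs]
      rw [e]
      exact (aestronglyMeasurable_indicator_iff (hKm _)).2 (hb.aestronglyMeasurable.restrict.smul
        (hT.continuousOn.aestronglyMeasurable_of_isCompact (hK _) (hKm _)))
    · filter_upwards [hns] with s hs
      exact hs.smul_const _
  refine (hb.norm.mul_const ‖a‖).mono' hmeas (.of_forall fun s => ?_)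
  rw [norm_smul]
  exact le_of_eq (congrArg _ (LinearIsometry.norm_map _ a))

/-- `L¹(G)` is closed under convolution: the product `b * a` is the Bochner integral of the
translates of `a` with weight `b`. This avoids Fubini's theorem, which is not available as `G` need
not be second countable. -/
lemma ofLp_conv_mem (b a : Lp ℂ 1 (Measure.haar : Measure G)) :
    ofLp G b * ofLp G a ∈ groupAlgebra G := by
  rw [← range_ofLp]
  have hint := integrable_smul_translateLp (L1.integrable_coeFn b) a
  refine ⟨∫ s, b s • translateLp s a ∂Measure.haar, ext_of_cintegral fun f => ?_⟩
  obtain ⟨C, hC0, hC⟩ := exists_bound f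
  rw [mul_spec, ← pairing_apply (map_continuous f) hC,
    ← ContinuousLinearMap.integral_comp_comm _ hint,
    cintegral_ofLp b (continuous_cintegral_translate _ (map_continuous f) hC)
      (norm_cintegral_translate_le _ hC0 hC)]
  refine integral_congr_ae (.of_forall fun s => ?_)
  change pairing f _ C hC (b s • translateLp s a) = _
  rw [map_smul, pairing_apply, ofLp_translateLp, cintegral_leftTranslate, smul_eq_mul, mul_comm]

lemma conv_mem_groupAlgebra {μ ν : MeasureAlgebra G} (hμ : μ ∈ groupAlgebra G)
    (hν : ν ∈ groupAlgebra G) : μ * ν ∈ groupAlgebra G := by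
  rw [← range_ofLp] at hμ hν
  obtain ⟨b, rfl⟩ := hμ
  obtain ⟨a, rfl⟩ := hν
  exact ofLp_conv_mem b a

end GroupAlgebra

/-! ### Spectra on the range of a linear map from a Banach space -/

/-- The range of a linear map with closed kernel on a Banach space is isomorphic to the quotient by
the kernel, which is again a Banach space, so that every operator induced from the Banach space has
a spectral value on the range. -/
lemma exists_not_bijective_on_range {E V : Type*} [NormedAddCommGroup E] [NormedSpace ℂ E]
    [CompleteSpace E] [AddCommGroup V] [Module ℂ V] (Φ : E →ₗ[ℂ] V)
    (hclosed : IsClosed (LinearMap.ker Φ : Set E)) (hΦ : Φ ≠ 0) (T : E →L[ℂ] E) (S : V →ₗ[ℂ] V)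
    (h : ∀ f, Φ (T f) = S (Φ f)) :
    ∃ c : ℂ, ¬ ((∀ v ∈ LinearMap.range Φ, S v = c • v → v = 0) ∧
      ∀ v ∈ LinearMap.range Φ, ∃ w ∈ LinearMap.range Φ, S w = c • w + v) := by
  set N := LinearMap.ker Φ with hN
  have : IsClosed (N : Set E) := hclosed
  have hmem : ∀ f : E, N.mkQ f = 0 ↔ Φ f = 0 := fun f => by
    rw [Submodule.mkQ_apply, Submodule.Quotient.mk_eq_zero, hN, LinearMap.mem_ker]
  have : Nontrivial (E ⧸ N) := by
    obtain ⟨f, hf⟩ : ∃ f, Φ f ≠ 0 := by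
      by_contra! h0
      exact hΦ (LinearMap.ext h0)
    exact ⟨N.mkQ f, 0, fun h0 => hf ((hmem f).1 h0)⟩
  let T' : (E ⧸ N) →L[ℂ] (E ⧸ N) := N.liftQL (N.mkQL.comp T) fun f hf => by
    have hf' : Φ f = 0 := hf
    change N.mkQ (T f) = 0
    rw [hmem, h, hf', map_zero]
  have hT' : ∀ f, T' (N.mkQ f) = N.mkQ (T f) := fun f => rfl
  obtain ⟨c, hc⟩ := spectrum.nonempty T'
  refine ⟨c, fun ⟨hinj, hsurj⟩ => hc ?_⟩
  have hval : ∀ f, (algebraMap ℂ ((E ⧸ N) →L[ℂ] (E ⧸ N)) c - T') (N.mkQ f) =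
      N.mkQ (c • f - T f) := fun f => by
    rw [map_sub, map_smul, ← hT']
    rfl
  rw [spectrum.mem_resolventSet_iff, ContinuousLinearMap.isUnit_iff_bijective]
  constructor
  · refine (injective_iff_map_eq_zero _).2 fun q hq => ?_
    obtain ⟨f, rfl⟩ := N.mkQ_surjective q
    rw [hval, hmem, map_sub, map_smul, h, sub_eq_zero] at hq
    exact (hmem f).2 (hinj _ ⟨f, rfl⟩ hq.symm)
  · intro q
    obtain ⟨f, rfl⟩ := N.mkQ_surjective q
    obtain ⟨-, ⟨w, rfl⟩, hw⟩ := hsurj (Φ f) ⟨f, rfl⟩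
    refine ⟨N.mkQ (-w), ?_⟩
    rw [hval, ← sub_eq_zero, ← map_sub, hmem, map_sub, map_sub, map_smul, h, map_neg, map_neg,
      hw, smul_neg]
    abel

/-! ### Minimal left ideals -/

lemma add_neg_smul_eq_iff {R V : Type*} [Ring R] [AddCommGroup V] [Module R V] {c : R}
    {u v w : V} : u + (-c) • v = w ↔ u = c • v + w := by
  rw [neg_smul, ← sub_eq_add_neg, sub_eq_iff_eq_add']

section Ideals

variable {G : Type*} [TopologicalSpace G] [T2Space G] [MeasurableSpace G] [BorelSpace G]
  [Group G] [IsTopologicalGroup G]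

variable (G) in
/-- The augmentation character `μ ↦ μ(G)` of `M(G)`. -/
noncomputable def augmentation : MeasureAlgebra G →ₗ[ℂ] ℂ where
  toFun μ := (μ : ComplexMeasure G) Set.univ
  map_add' _ _ := rfl
  map_smul' _ _ := rfl

lemma augmentation_leftTranslate (g : G) (μ : MeasureAlgebra G) :
    augmentation G (leftTranslate g μ) = augmentation G μ :=
  leftTranslate_apply g μ MeasurableSet.univ

variable [LocallyCompactSpace G]

lemma augmentation_conv (μ ν : MeasureAlgebra G) :
    augmentation G (μ * ν) = augmentation G μ * augmentation G ν :=
  mul_apply_univ μ ν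

/-- A minimal left ideal `I` that is not in the kernel of the augmentation meets it trivially, so
`ν * μ = ν(G) μ` for `ν` in the algebra and `μ ∈ I`. If `μ(G) ≠ 0`, comparing `μ * μ` with
`(δ_g * μ) * μ` shows that `μ` is translation-invariant. -/
lemma compactSpace_of_socle {B : Submodule ℂ (MeasureAlgebra G)}
    (hmul : ∀ μ ∈ B, ∀ ν ∈ B, μ * ν ∈ B) (htr : ∀ g : G, ∀ μ ∈ B, leftTranslate g μ ∈ B)
    {μ : MeasureAlgebra G} (hμ : μ ∈ socle B) (hμ0 : (μ : ComplexMeasure G) Set.univ ≠ 0) :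
    CompactSpace G := by
  obtain ⟨I, hI, ν, hνI, hν⟩ : ∃ I, IsMinimalLeftIdeal B I ∧ ∃ ν ∈ I, augmentation G ν ≠ 0 := by
    by_contra! hno
    have hle : socle B ≤ B ⊓ LinearMap.ker (augmentation G) := by
      refine sInf_le ⟨⟨inf_le_left, fun b hb x hx =>
        Submodule.mem_inf.2 ⟨hmul b hb x hx.1, ?_⟩⟩, fun I hI => ?_⟩
      · rw [LinearMap.mem_ker, augmentation_conv, LinearMap.mem_ker.1 hx.2, mul_zero]
      · exact le_inf hI.1.1 fun ν hν => LinearMap.mem_ker.2 (hno I hI ν hν)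
    exact hμ0 (LinearMap.mem_ker.1 (hle hμ).2)
  have hker : I ⊓ LinearMap.ker (augmentation G) = ⊥ := by
    refine (hI.2.2 (I ⊓ LinearMap.ker (augmentation G)) ⟨inf_le_left.trans hI.1.1,
      fun b hb x hx => Submodule.mem_inf.2 ⟨hI.1.2 b hb x hx.1, ?_⟩⟩
      inf_le_left).resolve_right fun h => ?_
    · rw [LinearMap.mem_ker, augmentation_conv, LinearMap.mem_ker.1 hx.2, mul_zero]
    · rw [← h] at hνI
      exact hν (LinearMap.mem_ker.1 hνI.2)
  have hconv : ∀ b ∈ B, b * ν = augmentation G b • ν := fun b hb => by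
    have hm : b * ν + (-augmentation G b) • ν ∈ I ⊓ LinearMap.ker (augmentation G) := by
      refine Submodule.mem_inf.2 ⟨I.add_mem (hI.1.2 b hb ν hνI) (I.smul_mem _ hνI), ?_⟩
      rw [LinearMap.mem_ker, map_add, map_smul, augmentation_conv, smul_eq_mul, neg_mul,
        add_neg_cancel]
    rw [hker, Submodule.mem_bot] at hm
    exact (add_neg_smul_eq_iff.1 hm).trans (add_zero _)
  have hνB := hI.1.1 hνI
  refine compactSpace_of_leftTranslate (μ := ν) (fun h => hν (by rw [h, map_zero])) fun g => ?_
  refine ⟨1, ?_⟩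
  have h1 := hconv _ (htr g ν hνB)
  rw [leftTranslate_conv, hconv ν hνB, map_smul, augmentation_leftTranslate] at h1
  rw [one_smul]
  exact smul_right_injective _ hν h1

lemma conv_zero (μ : MeasureAlgebra G) : μ * 0 = 0 := by
  simpa using conv_smul 0 μ 0

/-- Right multiplication by `x`, as a map from the Banach space `L¹(G)` to `M(G)`. -/
noncomputable def convRight (x : MeasureAlgebra G) :
    Lp ℂ 1 (Measure.haar : Measure G) →ₗ[ℂ] MeasureAlgebra G where
  toFun f := ofLp G f * x
  map_add' f g := by rw [map_add, add_conv]
  map_smul' c f := by rw [map_smul, smul_conv, RingHom.id_apply]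

lemma convRight_apply (x : MeasureAlgebra G) (f : Lp ℂ 1 (Measure.haar : Measure G)) :
    convRight x f = ofLp G f * x := rfl

/-- The kernel of `f ↦ f * x` is the common kernel of the functionals `f ↦ ∫ F f dλ` with
`F s = ∫ h(s y) dx(y)`, for `h` continuous with compact support. -/
lemma isClosed_ker_convRight (x : MeasureAlgebra G) :
    IsClosed (LinearMap.ker (convRight x) : Set (Lp ℂ 1 (Measure.haar : Measure G))) := by
  choose C hC0 hC using fun h : C_c(G, ℂ) => exists_bound h
  have e : (LinearMap.ker (convRight x) : Set (Lp ℂ 1 (Measure.haar : Measure G))) =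
      ⋂ h : C_c(G, ℂ), {f | pairing _ (continuous_cintegral_translate x (map_continuous h) (hC h))
        _ (norm_cintegral_translate_le _ (hC0 h) (hC h)) f = 0} := by
    ext f
    simp only [SetLike.mem_coe, LinearMap.mem_ker, Set.mem_iInter, Set.mem_ofPred_eq,
      pairing_apply, convRight_apply]
    simp_rw [← mul_spec]
    constructor
    · intro h0 h
      rw [h0]
      exact VectorMeasure.integral_zero_vectorMeasure
    · intro h0
      exact ext_of_cintegral fun h =>
        (h0 h).trans VectorMeasure.integral_zero_vectorMeasure.symm
  rw [e]
  exact isClosed_iInter fun h => isClosed_eq (ContinuousLinearMap.continuous _) continuous_const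

/-- `L¹(G)` has no nonzero right annihilators in `M(G)`. -/
lemma eq_zero_of_convRight {x : MeasureAlgebra G} (hx : convRight x = 0) : x = 0 := by
  refine ext_of_cintegral fun h => ?_
  refine Eq.trans ?_ VectorMeasure.integral_zero_vectorMeasure.symm
  obtain ⟨C, hC0, hC⟩ := exists_bound h
  set F : G → ℂ := fun s => cintegral (x : ComplexMeasure G) fun y => h (s * y) with hF
  have hFc : Continuous F := continuous_cintegral_translate x (map_continuous h) hC
  have hFb : ∀ s, ‖F s‖ ≤ C * (x : ComplexMeasure G).variation.real Set.univ :=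
    norm_cintegral_translate_le _ hC0 hC
  have hF1 : F 1 = cintegral (x : ComplexMeasure G) h := by simp [hF]
  rw [← hF1]
  by_contra hne
  -- Test against `φ · conj F` for a bump function `φ` at `1`.
  obtain ⟨φ, hφ1, hφc, hφ⟩ := exists_continuousMap_one_of_isCompact_subset_isOpen
    (isCompact_singleton (x := (1 : G))) isOpen_univ (Set.subset_univ _)
  have hcs : HasCompactSupport φ := hφc
  have hφ0 : ∀ s, 0 ≤ φ s := fun s => (hφ.2 s).1
  have hfcont : Continuous fun s => (φ s : ℂ) * starRingEnd ℂ (F s) :=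
    (Complex.continuous_ofReal.comp φ.continuous).mul (Complex.continuous_conj.comp hFc)
  have hfcs : HasCompactSupport fun s => (φ s : ℂ) * starRingEnd ℂ (F s) :=
    (hcs.comp_left (g := ((↑) : ℝ → ℂ)) Complex.ofReal_zero).mul_right
  have hfint : Integrable (fun s => (φ s : ℂ) * starRingEnd ℂ (F s)) Measure.haar :=
    hfcont.integrable_of_hasCompactSupport hfcs
  have h0 :
      cintegral ((ofLp G (hfint.toL1 _) * x : MeasureAlgebra G) : ComplexMeasure G) h = 0 := by
    rw [← convRight_apply, hx]
    exact VectorMeasure.integral_zero_vectorMeasure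
  rw [mul_spec, cintegral_ofLp _ hFc hFb] at h0
  have hpos : 0 < ∫ s, φ s * ‖F s‖ ^ 2 ∂(Measure.haar : Measure G) := by
    refine Continuous.integral_pos_of_hasCompactSupport_nonneg_nonzero (x := 1)
      (φ.continuous.mul (hFc.norm.pow 2)) hcs.mul_right
      (fun s => mul_nonneg (hφ0 s) (sq_nonneg _)) ?_
    have : φ 1 = 1 := hφ1 rfl
    rw [this, one_mul]
    exact pow_ne_zero 2 (norm_ne_zero_iff.2 hne)
  have h1 : ((∫ s, φ s * ‖F s‖ ^ 2 ∂(Measure.haar : Measure G) : ℝ) : ℂ) = 0 := by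
    rw [← h0, ← integral_complex_ofReal]
    refine integral_congr_ae ?_
    filter_upwards [hfint.coeFn_toL1] with s hs
    rw [hs, mul_left_comm, Complex.mul_conj, Complex.normSq_eq_norm_sq]
    push_cast
    rfl
  exact hpos.ne' (Complex.ofReal_eq_zero.1 h1)

/-- A minimal left ideal `I` of `L¹(G)` is `L¹(G) * x` for each nonzero `x ∈ I`, as the latter is
a nonzero left ideal. -/
lemma range_convRight {I : Submodule ℂ (MeasureAlgebra G)}
    (hI : IsMinimalLeftIdeal (groupAlgebra G) I) {x : MeasureAlgebra G} (hx : x ∈ I)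
    (hx0 : x ≠ 0) : LinearMap.range (convRight x) = I := by
  have hB : ∀ f, ofLp G f ∈ groupAlgebra G := fun f => by
    rw [← range_ofLp]
    exact ⟨f, rfl⟩
  have hle : LinearMap.range (convRight x) ≤ I := by
    rintro _ ⟨f, rfl⟩
    exact hI.1.2 _ (hB f) x hx
  refine (hI.2.2 _ ⟨hle.trans hI.1.1, ?_⟩ hle).resolve_left fun h => ?_
  · rintro b hb _ ⟨f, rfl⟩
    have hbf := conv_mem_groupAlgebra hb (hB f)
    rw [← range_ofLp] at hbf
    obtain ⟨k, hk⟩ := hbf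
    refine ⟨k, ?_⟩
    rw [convRight_apply, convRight_apply, hk, conv_assoc]
  · exact hx0 (eq_zero_of_convRight (LinearMap.range_eq_bot.1 h))

/-- If `G` is abelian, then translations act on a minimal ideal `I` of `L¹(G)` by scalars: the
kernel and the range of `δ_g - c` on `I` are ideals, so `δ_g - c` is zero or bijective on `I`,
and it is not bijective for a spectral value `c`. -/
lemma exists_leftTranslate_eq_smul (hG : ∀ x y : G, x * y = y * x)
    {I : Submodule ℂ (MeasureAlgebra G)} (hI : IsMinimalLeftIdeal (groupAlgebra G) I)
    {x : MeasureAlgebra G} (hx : x ∈ I) (hx0 : x ≠ 0) (g : G) :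
    ∃ c : ℂ, leftTranslate g x = c • x := by
  have hcomm : ∀ f, convRight x (translateLp g f) = leftTranslate g (convRight x f) := fun f => by
    rw [convRight_apply, convRight_apply, ofLp_translateLp, leftTranslate_conv]
  obtain ⟨c, hc⟩ := exists_not_bijective_on_range (E := Lp ℂ 1 (Measure.haar : Measure G))
    (V := MeasureAlgebra G) (convRight x) (isClosed_ker_convRight x)
    (fun h => hx0 (eq_zero_of_convRight h)) (translateLp g) (leftTranslate g) hcomm
  have hrange := range_convRight hI hx hx0
  have hstable : ∀ v ∈ I, leftTranslate g v ∈ I := by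
    intro v hv
    rw [← hrange] at hv ⊢
    obtain ⟨f, rfl⟩ := hv
    exact ⟨translateLp g f, hcomm f⟩
  rw [hrange] at hc
  let D : MeasureAlgebra G →ₗ[ℂ] MeasureAlgebra G :=
    { toFun := fun v => leftTranslate g v + (-c) • v
      map_add' := fun v w => by rw [map_add, smul_add, add_add_add_comm]
      map_smul' := fun z v => by rw [map_smul, RingHom.id_apply, smul_add, smul_comm] }
  have hD : ∀ v, D v = leftTranslate g v + (-c) • v := fun v => rfl
  have hD0 : ∀ v w, D v = w ↔ leftTranslate g v = c • v + w := fun v w =>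
    add_neg_smul_eq_iff (R := ℂ) (V := MeasureAlgebra G)
  have hDconv : ∀ b v, b * D v = D (b * v) := fun b v => by
    rw [hD, hD, conv_add, conv_leftTranslate hG, conv_smul]
  have hDI : I.map D ≤ I := by
    rintro _ ⟨v, hv, rfl⟩
    rw [hD]
    exact I.add_mem (hstable v hv) (I.smul_mem (-c) hv)
  refine ⟨c, ?_⟩
  rw [← add_zero (c • x), ← hD0]
  by_contra hDx
  refine hc ⟨fun v hv h => ?_, fun v hv => ?_⟩
  · have hker : I ⊓ LinearMap.ker D = ⊥ := by
      refine (hI.2.2 (I ⊓ LinearMap.ker D) ⟨inf_le_left.trans hI.1.1, fun b hb v hv =>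
        Submodule.mem_inf.2 ⟨hI.1.2 b hb v hv.1, ?_⟩⟩ inf_le_left).resolve_right fun h => ?_
      · rw [LinearMap.mem_ker, ← hDconv, LinearMap.mem_ker.1 hv.2, conv_zero]
      · rw [← h] at hx
        exact hDx (LinearMap.mem_ker.1 hx.2)
    have hm : v ∈ I ⊓ LinearMap.ker D :=
      Submodule.mem_inf.2 ⟨hv, by rw [LinearMap.mem_ker, hD0, h, add_zero]⟩
    rwa [hker, Submodule.mem_bot] at hm
  · have hmap : I.map D = I := by
      refine (hI.2.2 (I.map D) ⟨hDI.trans hI.1.1, ?_⟩ hDI).resolve_left fun h => ?_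
      · rintro b hb _ ⟨v, hv, rfl⟩
        exact ⟨b * v, hI.1.2 b hb v hv, (hDconv b v).symm⟩
      · have hm : D x ∈ I.map D := ⟨x, hx, rfl⟩
        rw [h, Submodule.mem_bot] at hm
        exact hDx hm
    rw [← hmap] at hv
    obtain ⟨w, hw, hwv⟩ := hv
    exact ⟨w, hw, (hD0 w v).1 hwv⟩

lemma exists_isMinimalLeftIdeal_of_socle_ne_bot {B : Submodule ℂ (MeasureAlgebra G)}
    (h : socle B ≠ ⊥) : ∃ I, IsMinimalLeftIdeal B I := by
  by_contra! hno
  refine h (le_bot_iff.1 (sInf_le ⟨⟨bot_le, fun b _ x hx => ?_⟩, fun I hI => (hno I hI).elim⟩))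
  rw [Submodule.mem_bot] at hx ⊢
  rw [hx, conv_zero]

end Ideals

end LCGroup

theorem theorem2 (G : Type*) [Group G] [TopologicalSpace G] [IsTopologicalGroup G]
    [LocallyCompactSpace G] [T2Space G] [MeasurableSpace G] [BorelSpace G]
    (h : (∃ μ : LCGroup.MeasureAlgebra G, μ ∈ LCGroup.socle (LCGroup.groupAlgebra G) ∧
        (μ : ComplexMeasure G) Set.univ ≠ 0) ∨
      (∃ μ : LCGroup.MeasureAlgebra G,
        μ ∈ LCGroup.socle (⊤ : Submodule ℂ (LCGroup.MeasureAlgebra G)) ∧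
        (μ : ComplexMeasure G) Set.univ ≠ 0) ∨
      ((∀ x y : G, x * y = y * x) ∧ LCGroup.socle (LCGroup.groupAlgebra G) ≠ ⊥)) :
    CompactSpace G := by
  rcases h with ⟨μ, hμ, hμ0⟩ | ⟨μ, hμ, hμ0⟩ | ⟨hG, hsoc⟩
  · exact LCGroup.compactSpace_of_socle (fun _ h₁ _ h₂ => LCGroup.conv_mem_groupAlgebra h₁ h₂)
      (fun g _ h => LCGroup.leftTranslate_mem_groupAlgebra g h) hμ hμ0
  · exact LCGroup.compactSpace_of_socle (fun _ _ _ _ => Submodule.mem_top)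
      (fun _ _ _ => Submodule.mem_top) hμ hμ0
  · obtain ⟨I, hI⟩ := LCGroup.exists_isMinimalLeftIdeal_of_socle_ne_bot hsoc
    obtain ⟨x, hx, hx0⟩ := I.exists_mem_ne_zero_of_ne_bot hI.2.1
    exact LCGroup.compactSpace_of_leftTranslate hx0
      (LCGroup.exists_leftTranslate_eq_smul hG hI hx hx0)
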